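/- Let $\mathbb{H}$ be the quaternions and regard $\mathbb{H}^n\cong\mathbb{R}^{4n}$ as a right $\mathbb{H}$-module. For an open set $\Omega\subseteq\mathbb{H}^n$, let $PSH(\Omega)$ be the set of quaternionic plurisubharmonic functions on $\Omega$: upper semicontinuous functions $u:\Omega\to[-\infty,\infty)$, not identically $-\infty$ on any connected component of $\Omega$, such that for all $a,b\in\mathbb{H}^n$ with $b\neq0$ the function $q\mapsto u(a+bq)$ is, on each connected component of the open set $\{q\in\mathbb{H}: a+bq\in\Omega\}$, subharmonic or identically $-\infty$. For $E\subseteq\Omega$, the relative extremal function of $E$ in $\Omega$ is $$u_E(q)=\sup\{u(q): u\in PSH(\Omega),\ u\le 0 \text{ on } \Omega,\ u\le -1 \text{ on } E\},\qquad q\in\Omega,$$ and $u_E^*(q)=\limsup_{\Omega\ni q'\to q}u_E(q')$ (with $q'=q$ allowed), $q\in\Omega$, is its upper semicontinuous regularization. **Proposition.** Let $\Omega\subseteq\mathbb{H}^n$ be a nonempty connected open set and let $E\subseteq\Omega$ be an arbitrary subset. Then the following are equivalent: 1. $u_E^*(q)=0$ for all $q\in\Omega$; 2. there exists $v\in PSH(\Omega)$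 with $v\le 0$ on $\Omega$ and $E\subseteq\{q\in\Omega: v(q)=-\infty\}$. -/

import Mathlib

open MeasureTheory Set Filter Topology
open scoped ENNReal

noncomputable section

instance Quaternion.borelMeasurableSpace : MeasurableSpace (Quaternion ℝ) := borel (Quaternion ℝ)

instance Quaternion.borelBorelSpace : BorelSpace (Quaternion ℝ) := ⟨rfl⟩

/-- The Lebesgue integral of an extended real valued function, `∫ f⁺ - ∫ f⁻`. It is only used for
functions which are bounded above on a finite measure space, so that `∫ f⁺` is finite and the
integral is an element of `[-∞, ∞)`. -/
def erealIntegral {α : Type*} [MeasurableSpace α] (μ : Measure α) (f : α → EReal) : EReal :=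
  ((∫⁻ x, (f x).toENNReal ∂μ : ℝ≥0∞) : EReal) - ((∫⁻ x, (-f x).toENNReal ∂μ : ℝ≥0∞) : EReal)

section Subharmonic

variable {F : Type*} [NormedAddCommGroup F] [InnerProductSpace ℝ F] [FiniteDimensional ℝ F]
  [MeasurableSpace F] [BorelSpace F]

/-- The surface measure of the unit sphere, normalized to total mass one. -/
def unitSphereMeasure (F : Type*) [NormedAddCommGroup F] [InnerProductSpace ℝ F]
    [FiniteDimensional ℝ F] [MeasurableSpace F] [BorelSpace F] :
    Measure (Metric.sphere (0 : F) 1) :=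
  ((volume : Measure F).toSphere univ)⁻¹ • (volume : Measure F).toSphere

/-- The mean value of `u` over the sphere with centre `c` and radius `r`. -/
def sphereMean (u : F → EReal) (c : F) (r : ℝ) : EReal :=
  erealIntegral (unitSphereMeasure F) (fun ω => u (c + r • (ω : F)))

/-- `u : G → [-∞, ∞)` is upper semicontinuous and satisfies the sub-mean value inequality on every
sphere that bounds a closed ball contained in the open set `G`. Equivalently, on every connected
component of `G` the function `u` is subharmonic or identically `-∞`. -/
structure IsSubharmonicOrBotOn (u : F → EReal) (G : Set F) : Prop where
  upperSemicontinuousOn : UpperSemicontinuousOn u G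
  lt_top : ∀ x ∈ G, u x < ⊤
  le_sphereMean : ∀ (c : F) (r : ℝ), 0 < r → Metric.closedBall c r ⊆ G → u c ≤ sphereMean u c r

end Subharmonic

/-- The parametrization `q ↦ a + b q` of the right quaternionic line in `ℍⁿ` through `a` in the
direction `b ≠ 0`. -/
def rightLine {n : ℕ} (a b : Fin n → Quaternion ℝ) (q : Quaternion ℝ) : Fin n → Quaternion ℝ :=
  fun i => a i + b i * q

/-- `u ∈ PSH(Ω)` for an open set `Ω` in `ℍⁿ`: `u : Ω → [-∞, ∞)` is upper semicontinuous, is not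
identically `-∞` on any connected component of `Ω`, and its restriction to each right quaternionic
line is subharmonic (or identically `-∞`, on each component). The values of `u` outside `Ω` play
no role. -/
structure IsQuatPSH {n : ℕ} (Ω : Set (Fin n → Quaternion ℝ))
    (u : (Fin n → Quaternion ℝ) → EReal) : Prop where
  upperSemicontinuousOn : UpperSemicontinuousOn u Ω
  lt_top : ∀ q ∈ Ω, u q < ⊤
  exists_ne_bot : ∀ q ∈ Ω, ∃ q' ∈ connectedComponentIn Ω q, u q' ≠ ⊥
  subharmonic_line : ∀ a b : Fin n → Quaternion ℝ, b ≠ 0 →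
    IsSubharmonicOrBotOn (fun q => u (rightLine a b q)) (rightLine a b ⁻¹' Ω)

/-- The relative extremal function `u_{E,Ω}`. -/
def relExtremal {n : ℕ} (E Ω : Set (Fin n → Quaternion ℝ)) (q : Fin n → Quaternion ℝ) : EReal :=
  sSup {t : EReal | ∃ u : (Fin n → Quaternion ℝ) → EReal, IsQuatPSH Ω u ∧
    (∀ p ∈ Ω, u p ≤ 0) ∧ (∀ p ∈ E, u p ≤ -1) ∧ t = u q}

/-- The upper semicontinuous regularization `u^*(q) = limsup_{q' → q, q' ∈ Ω} u(q')` of a function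
`u` on `Ω`; the point `q' = q` is allowed, so that `u ≤ u^*`. -/
def uscReg {X : Type*} [TopologicalSpace X] (Ω : Set X) (u : X → EReal) (q : X) : EReal :=
  limsup u (𝓝[Ω] q)

end

/-!
Both implications are proved for the nonnegative lower semicontinuous functions `w = -u`, with values
in `ℝ≥0∞`, attached to the nonpositive plurisubharmonic functions `u`. On this side scalings
and infinite sums carry no sign or infinity conventions: positive multiples and countable sums of
plurisuperharmonic functions are plurisuperharmonic, by monotone convergence
(`IsQuatPlurisuperharmonicOn.const_mul`, `IsQuatPlurisuperharmonicOn.tsum`).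

If `v ≤ 0` is plurisubharmonic and `v = -∞` on `E`, then all the functions `v / k` compete in the
definition of the relative extremal function, which therefore vanishes wherever `v ≠ -∞`. This set is
dense in `Ω`: if `v = -∞` near a point `p'`, then the sub-mean value inequality on the quaternionic
line through `x` and `p'`, for the sphere centred at `x` passing through `p'`, forces `v x = -∞` for
all `x` near `p'`, at a distance controlled by the distance to the boundary only; connectedness of `Ω`
finishes the argument (`IsQuatPlurisuperharmonicOn.frequently_ne_top`).

Conversely, fix `q₀ ∈ Ω`. As the regularized extremal function vanishes at `q₀`, there are competitors
`u j` and points `q j` close to `q₀` with `u j (q j) > -ε j`, where `∑ ε j < ∞`. Averaging the sub-mean value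
inequality over all directions bounds the integral of `-u j` over a fixed ball around `q₀` by a constant
times `ε j` (`IsQuatPlurisuperharmonicOn.lintegral_ball_le`). Hence `v = ∑ u j` is finite almost
everywhere on that ball; it is plurisubharmonic, and it equals `-∞` on `E` because every term is at most
`-1` there. No choice of a countable family representing the regularization is needed.
-/

open scoped Quaternion

/-! ### Normalized surface measure and integrals of nonpositive functions -/

section SphereMean

variable {F : Type*} [NormedAddCommGroup F] [InnerProductSpace ℝ F] [FiniteDimensional ℝ F]
  [MeasurableSpace F] [BorelSpace F]

instance unitSphereMeasure.instIsProbabilityMeasure [Nontrivial F] :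
    IsProbabilityMeasure (unitSphereMeasure F) where
  measure_univ := by
    rw [unitSphereMeasure, Measure.smul_apply, smul_eq_mul]
    exact ENNReal.inv_mul_cancel (Measure.measure_univ_ne_zero.2 (Measure.toSphere_ne_zero _))
      (measure_ne_top _ _)

instance unitSphereMeasure.instIsOpenPosMeasure : (unitSphereMeasure F).IsOpenPosMeasure where
  open_pos U hU hne := by
    rw [unitSphereMeasure, Measure.smul_apply, smul_eq_mul]
    exact mul_ne_zero (ENNReal.inv_ne_zero.2 (measure_ne_top _ _)) (hU.measure_ne_zero _ hne)

end SphereMean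

theorem erealIntegral_of_nonpos {α : Type*} [MeasurableSpace α] (μ : Measure α) {f : α → EReal}
    (hf : ∀ x, f x ≤ 0) :
    erealIntegral μ f = -((∫⁻ x, (-f x).toENNReal ∂μ : ℝ≥0∞) : EReal) := by
  have h : ∀ x, (f x).toENNReal = 0 := fun x => EReal.toENNReal_of_nonpos (hf x)
  simp [erealIntegral, h]

theorem EReal.neg_coe_ennreal_nonpos (x : ℝ≥0∞) : -(x : EReal) ≤ 0 :=
  EReal.neg_le_zero.2 (EReal.coe_ennreal_nonneg x)

theorem EReal.antitone_neg_toENNReal : Antitone fun x : EReal => (-x).toENNReal :=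
  fun _ _ h => EReal.toENNReal_le_toENNReal (EReal.neg_le_neg_iff.2 h)

theorem EReal.neg_toENNReal_neg {x : EReal} (hx : x ≤ 0) : -(((-x).toENNReal : ℝ≥0∞) : EReal) = x := by
  rw [EReal.coe_toENNReal (by simpa using EReal.neg_le_neg_iff.2 hx), neg_neg]

/-! ### Quaternionic lines -/

section RightLine

variable {n : ℕ}

theorem rightLine_zero_right (a b : Fin n → ℍ) : rightLine a b 0 = a := by
  ext1 i; simp [rightLine]

theorem rightLine_zero_left (a : Fin n → ℍ) (q : ℍ) : rightLine a 0 q = a := by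
  ext1 i; simp [rightLine]

theorem rightLine_add_smul (a b : Fin n → ℍ) (c : ℍ) (r : ℝ) (q : ℍ) :
    rightLine a b (c + r • q) = rightLine (rightLine a b c) (r • b) q := by
  ext1 i; simp [rightLine, mul_add, add_assoc]

theorem dist_rightLine_le (a b : Fin n → ℍ) (q : ℍ) : dist (rightLine a b q) a ≤ ‖b‖ * ‖q‖ := by
  refine (dist_pi_le_iff (by positivity)).2 fun i => ?_
  rw [dist_eq_norm, rightLine, add_sub_cancel_left, norm_mul]
  gcongr
  exact norm_le_pi_norm b i

theorem continuous_rightLine (a b : Fin n → ℍ) : Continuous (rightLine a b) := by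
  unfold rightLine; fun_prop

/-- Right multiplication by a unit quaternion is an isometry of each factor `ℍ`, so it preserves
Lebesgue measure on `ℍⁿ`. -/
theorem measurePreserving_mul_right {ω : ℍ} (hω : ‖ω‖ = 1) :
    MeasurePreserving (fun (b : Fin n → ℍ) i => b i * ω) := by
  have hne : ω ≠ 0 := norm_ne_zero_iff.1 (by simp [hω])
  let e : ℍ ≃ₗᵢ[ℝ] ℍ :=
    { toFun := fun q => q * ω
      invFun := fun q => q * ω⁻¹
      left_inv := fun q => by simp [hne]
      right_inv := fun q => by simp [hne]
      map_add' := fun p q => add_mul p q ω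
      map_smul' := fun r q => smul_mul_assoc r q ω
      norm_map' := fun q => by simp [hω] }
  exact volume_preserving_pi fun _ => e.measurePreserving

/-- The integral over the directions `b` in a ball does not depend on the unit quaternion `ω`. -/
theorem setLIntegral_ball_rightLine (f : (Fin n → ℍ) → ℝ≥0∞) (hf : Measurable f)
    (p : Fin n → ℍ) (R : ℝ) {ω : ℍ} (hω : ‖ω‖ = 1) :
    ∫⁻ b in Metric.ball 0 R, f (rightLine p b ω) = ∫⁻ x in Metric.ball p R, f x := by
  have hmp := (measurePreserving_add_left volume p).comp (measurePreserving_mul_right (n := n) hω)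
  have hpre : ((p + ·) ∘ fun (b : Fin n → ℍ) i => b i * ω) ⁻¹' Metric.ball p R = Metric.ball 0 R := by
    ext b
    rcases le_or_gt R 0 with hR | hR
    · simp [Metric.ball_eq_empty.2 hR]
    · simp [dist_eq_norm, pi_norm_lt_iff hR, hω]
  rw [← hmp.setLIntegral_comp_preimage Metric.isOpen_ball.measurableSet hf, hpre]
  rfl

end RightLine

/-! ### Nonnegative plurisuperharmonic functions -/

/-- `w : Ω → [0, ∞]` is lower semicontinuous and satisfies the super-mean value inequality on the unit
sphere of each parametrized quaternionic line whose closed unit ball lies in `Ω`. Reparametrizing the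
line gives all spheres of positive radius, and `b = 0` is harmless. The function `w` may be
identically `∞`. -/
structure IsQuatPlurisuperharmonicOn {n : ℕ} (Ω : Set (Fin n → ℍ)) (w : (Fin n → ℍ) → ℝ≥0∞) :
    Prop where
  lowerSemicontinuousOn : LowerSemicontinuousOn w Ω
  lintegral_sphere_le : ∀ a b : Fin n → ℍ, MapsTo (rightLine a b) (Metric.closedBall 0 1) Ω →
    ∫⁻ ω, w (rightLine a b (ω : ℍ)) ∂(unitSphereMeasure ℍ) ≤ w a

section Plurisuperharmonic

variable {n : ℕ} {Ω : Set (Fin n → ℍ)} {w : (Fin n → ℍ) → ℝ≥0∞}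

theorem LowerSemicontinuousOn.measurable_indicator {X : Type*} [TopologicalSpace X]
    [MeasurableSpace X] [OpensMeasurableSpace X] {s : Set X} {f : X → ℝ≥0∞}
    (hf : LowerSemicontinuousOn f s) (hs : IsOpen s) : Measurable (s.indicator f) := by
  refine LowerSemicontinuous.measurable fun x y hy => ?_
  by_cases hx : x ∈ s
  · have hy : y < s.indicator f x := hy
    rw [indicator_of_mem hx] at hy
    have h := hf x hx y hy
    rw [hs.nhdsWithin_eq hx] at h
    filter_upwards [h, hs.mem_nhds hx] with z hz hzs
    simpa [indicator_of_mem hzs] using hz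
  · simp [indicator_of_notMem hx] at hy

theorem IsQuatPSH.isQuatPlurisuperharmonicOn {u : (Fin n → ℍ) → EReal} (hu : IsQuatPSH Ω u)
    (h0 : ∀ q ∈ Ω, u q ≤ 0) : IsQuatPlurisuperharmonicOn Ω fun q => (-u q).toENNReal where
  lowerSemicontinuousOn :=
    (EReal.continuous_toENNReal.comp continuous_neg).comp_upperSemicontinuousOn_antitone
      hu.upperSemicontinuousOn EReal.antitone_neg_toENNReal
  lintegral_sphere_le a b hab := by
    rcases eq_or_ne b 0 with rfl | hb
    · simp [rightLine_zero_left]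
    · have h := (hu.subharmonic_line a b hb).le_sphereMean 0 1 one_pos hab
      have hle : ∀ ω : Metric.sphere (0 : ℍ) 1, u (rightLine a b (ω : ℍ)) ≤ 0 := fun ω =>
        h0 _ (hab (Metric.sphere_subset_closedBall ω.2))
      simp only [sphereMean, one_smul, zero_add, rightLine_zero_right] at h
      rw [erealIntegral_of_nonpos _ hle, EReal.le_neg] at h
      simpa using EReal.toENNReal_le_toENNReal h

namespace IsQuatPlurisuperharmonicOn

theorem isQuatPSH (hw : IsQuatPlurisuperharmonicOn Ω w) (hΩ : IsPreconnected Ω)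
    (hne : ∃ q ∈ Ω, w q ≠ ⊤) : IsQuatPSH Ω fun q => -(w q : EReal) where
  upperSemicontinuousOn :=
    (continuous_neg.comp continuous_coe_ennreal_ereal).comp_lowerSemicontinuousOn_antitone
      hw.lowerSemicontinuousOn fun _ _ h => by simpa using h
  lt_top q _ := (EReal.neg_coe_ennreal_nonpos _).trans_lt EReal.zero_lt_top
  exists_ne_bot q hq := by
    obtain ⟨p, hp, hwp⟩ := hne
    exact ⟨p, hΩ.subset_connectedComponentIn hq subset_rfl hp, by simpa using hwp⟩
  subharmonic_line a b _ :=
    { upperSemicontinuousOn :=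
        ((continuous_neg.comp continuous_coe_ennreal_ereal).comp_lowerSemicontinuousOn_antitone
          hw.lowerSemicontinuousOn fun _ _ h => by simpa using h).comp
            (continuous_rightLine a b).continuousOn fun _ h => h
      lt_top := fun q _ => (EReal.neg_coe_ennreal_nonpos _).trans_lt EReal.zero_lt_top
      le_sphereMean := fun c r hr hc => by
        rw [sphereMean, erealIntegral_of_nonpos _ fun _ => EReal.neg_coe_ennreal_nonpos _]
        simp only [neg_neg, EReal.toENNReal_coe, rightLine_add_smul, EReal.neg_le_neg_iff,
          EReal.coe_ennreal_le_coe_ennreal_iff]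
        refine hw.lintegral_sphere_le _ _ fun q hq => ?_
        rw [← rightLine_add_smul]
        refine hc ?_
        have hq' : ‖q‖ ≤ 1 := by simpa using hq
        simpa [norm_smul, abs_of_pos hr] using mul_le_mul_of_nonneg_left hq' hr.le }

theorem const_mul (hw : IsQuatPlurisuperharmonicOn Ω w) {c : ℝ≥0∞} (hc : c ≠ ⊤) :
    IsQuatPlurisuperharmonicOn Ω fun q => c * w q where
  lowerSemicontinuousOn :=
    (ENNReal.continuous_const_mul hc).comp_lowerSemicontinuousOn hw.lowerSemicontinuousOn
      fun _ _ h => by dsimp only; gcongr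
  lintegral_sphere_le a b hab := by
    rw [lintegral_const_mul' _ _ hc]
    gcongr
    exact hw.lintegral_sphere_le a b hab

theorem measurable_sphere (hw : IsQuatPlurisuperharmonicOn Ω w) {a b : Fin n → ℍ}
    (hab : MapsTo (rightLine a b) (Metric.closedBall 0 1) Ω) :
    Measurable fun ω : Metric.sphere (0 : ℍ) 1 => w (rightLine a b (ω : ℍ)) := by
  refine LowerSemicontinuous.measurable (lowerSemicontinuousOn_univ_iff.1 ?_)
  exact hw.lowerSemicontinuousOn.comp
    ((continuous_rightLine a b).comp continuous_subtype_val).continuousOn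
    fun ω _ => hab (Metric.sphere_subset_closedBall ω.2)

theorem tsum {ι : Type*} [Countable ι] {w : ι → (Fin n → ℍ) → ℝ≥0∞}
    (hw : ∀ i, IsQuatPlurisuperharmonicOn Ω (w i)) :
    IsQuatPlurisuperharmonicOn Ω fun q => ∑' i, w i q where
  lowerSemicontinuousOn := lowerSemicontinuousOn_tsum fun i => (hw i).lowerSemicontinuousOn
  lintegral_sphere_le a b hab := by
    rw [lintegral_tsum fun i => ((hw i).measurable_sphere hab).aemeasurable]
    exact ENNReal.tsum_le_tsum fun i => (hw i).lintegral_sphere_le a b hab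

/-- The super-mean value inequality on balls of `ℍⁿ` for the supremum norm, that is, on polydiscs. It
follows from the inequality on the spheres `ω ↦ p + b ω`, averaged over all `b` in the ball. -/
theorem lintegral_ball_le (hw : IsQuatPlurisuperharmonicOn Ω w) (hΩ : IsOpen Ω) {p : Fin n → ℍ}
    {R : ℝ} (hball : Metric.ball p R ⊆ Ω) :
    ∫⁻ x in Metric.ball p R, w x ≤ w p * volume (Metric.ball p R) := by
  set g := Ω.indicator w
  have hg : Measurable g := hw.lowerSemicontinuousOn.measurable_indicator hΩ
  have hgw : ∀ q ∈ Ω, g q = w q := fun q hq => indicator_of_mem hq w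
  have hmaps : ∀ b ∈ Metric.ball (0 : Fin n → ℍ) R,
      MapsTo (rightLine p b) (Metric.closedBall 0 1) Ω := fun b hb q hq => by
    refine hball ((dist_rightLine_le p b q).trans_lt (lt_of_le_of_lt ?_ (by simpa using hb)))
    exact mul_le_of_le_one_right (norm_nonneg b) (by simpa using hq)
  have hmeas : Measurable
      (Function.uncurry fun (ω : Metric.sphere (0 : ℍ) 1) b => g (rightLine p b (ω : ℍ))) := by
    refine hg.comp (Continuous.measurable ?_)
    unfold rightLine; fun_prop
  calc ∫⁻ x in Metric.ball p R, w x
      = ∫⁻ x in Metric.ball p R, g x :=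
        (setLIntegral_congr_fun Metric.isOpen_ball.measurableSet
          fun x hx => (hgw x (hball hx)).symm)
    _ = ∫⁻ ω, (∫⁻ b in Metric.ball 0 R, g (rightLine p b (ω : ℍ))) ∂(unitSphereMeasure ℍ) := by
        have h : ∀ ω : Metric.sphere (0 : ℍ) 1, ∫⁻ b in Metric.ball 0 R,
            g (rightLine p b (ω : ℍ)) = ∫⁻ x in Metric.ball p R, g x := fun ω =>
          setLIntegral_ball_rightLine g hg p R (norm_eq_of_mem_sphere ω)
        simp [h]
    _ = ∫⁻ b in Metric.ball 0 R, ∫⁻ ω, g (rightLine p b (ω : ℍ)) ∂(unitSphereMeasure ℍ) :=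
        lintegral_lintegral_swap hmeas.aemeasurable
    _ ≤ ∫⁻ _b in Metric.ball (0 : Fin n → ℍ) R, w p := by
        refine setLIntegral_mono' Metric.isOpen_ball.measurableSet fun b hb => ?_
        refine le_trans (lintegral_mono fun ω => ?_) (hw.lintegral_sphere_le p b (hmaps b hb))
        exact indicator_le_self Ω w _
    _ = w p * volume (Metric.ball p R) := by
        rw [setLIntegral_const, Measure.addHaar_ball_center volume p R]

/-- If `w = ∞` near a point `y`, then `w x = ∞` as soon as the closed ball centred at `x` with `y`
on its boundary lies in `Ω`. -/
theorem eq_top_of_eventually_eq_top (hw : IsQuatPlurisuperharmonicOn Ω w) {x y : Fin n → ℍ}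
    (hxy : Metric.closedBall x (dist x y) ⊆ Ω) (hy : ∀ᶠ z in 𝓝 y, w z = ⊤) : w x = ⊤ := by
  obtain ⟨U, hU, hUo, hyU⟩ := eventually_nhds_iff.1 hy
  have hmaps : MapsTo (rightLine x (y - x)) (Metric.closedBall 0 1) Ω := fun q hq => by
    refine hxy ((dist_rightLine_le x (y - x) q).trans ?_)
    rw [dist_comm x y, dist_eq_norm]
    exact mul_le_of_le_one_right (norm_nonneg _) (by simpa using hq)
  -- The set of points of the sphere which the line maps into `U` is open, and it contains `ω = 1`.
  set V : Set (Metric.sphere (0 : ℍ) 1) := {ω | rightLine x (y - x) (ω : ℍ) ∈ U}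
  have hVo : IsOpen V := hUo.preimage ((continuous_rightLine _ _).comp continuous_subtype_val)
  have hV : V.Nonempty := by
    refine ⟨⟨1, by simp⟩, ?_⟩
    have h1 : rightLine x (y - x) 1 = y := by ext1 i; simp [rightLine]
    simpa [V, h1] using hyU
  have hVpos : unitSphereMeasure ℍ V ≠ 0 := hVo.measure_ne_zero _ hV
  refine top_le_iff.1 (le_trans ?_ (hw.lintegral_sphere_le x (y - x) hmaps))
  calc (⊤ : ℝ≥0∞) = ∫⁻ _ω in V, ⊤ ∂(unitSphereMeasure ℍ) := by
        rw [setLIntegral_const, ENNReal.top_mul hVpos]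
    _ = ∫⁻ ω in V, w (rightLine x (y - x) (ω : ℍ)) ∂(unitSphereMeasure ℍ) :=
        setLIntegral_congr_fun hVo.measurableSet fun ω hω => (hU _ hω).symm
    _ ≤ _ := setLIntegral_le_lintegral _ _

/-- On a connected open set, a plurisuperharmonic function which is not identically `∞` is finite on
a dense set. -/
theorem frequently_ne_top (hw : IsQuatPlurisuperharmonicOn Ω w) (hΩ : IsOpen Ω)
    (hΩc : IsPreconnected Ω) (hne : ∃ q ∈ Ω, w q ≠ ⊤) {p : Fin n → ℍ} (hp : p ∈ Ω) :
    ∃ᶠ q in 𝓝 p, w q ≠ ⊤ := by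
  intro hev
  simp only [not_not] at hev
  obtain ⟨q, hq, hwq⟩ := hne
  have hsub : Ω ⊆ {y | ∀ᶠ z in 𝓝 y, w z = ⊤} := by
    refine hΩc.subset_of_closure_inter_subset isOpen_setOfPred_eventually_nhds ⟨p, hp, hev⟩ ?_
    rintro z ⟨hz, hzΩ⟩
    obtain ⟨r, hr, hrΩ⟩ := Metric.isOpen_iff.1 hΩ z hzΩ
    obtain ⟨y, hy, hzy⟩ := Metric.mem_closure_iff.1 hz (r / 3) (by positivity)
    filter_upwards [Metric.ball_mem_nhds z (show 0 < r / 3 by positivity)] with x hx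
    refine hw.eq_top_of_eventually_eq_top (fun t ht => hrΩ ?_) hy
    -- `dist t z ≤ dist x y + dist x z ≤ 2 dist x z + dist z y < r`
    rw [Metric.mem_closedBall] at ht
    rw [Metric.mem_ball] at hx ⊢
    linarith [dist_triangle t x z, dist_triangle x z y]
  exact hwq (hsub hq).self_of_nhds

end IsQuatPlurisuperharmonicOn

end Plurisuperharmonic

/-! ### The relative extremal function -/

section RelExtremal

variable {n : ℕ} {E Ω : Set (Fin n → ℍ)}

theorem relExtremal_nonpos {q : Fin n → ℍ} (hq : q ∈ Ω) : relExtremal E Ω q ≤ 0 := by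
  refine sSup_le ?_
  rintro t ⟨u, -, hu, -, rfl⟩
  exact hu q hq

/-- Every multiple `v / k` of a nonpositive plurisubharmonic function `v` with `E ⊆ {v = -∞}` competes
in the definition of the relative extremal function. -/
theorem relExtremal_eq_zero_of_ne_bot (hΩ : IsPreconnected Ω)
    {v : (Fin n → ℍ) → EReal} (hv : IsQuatPSH Ω v) (hv0 : ∀ q ∈ Ω, v q ≤ 0)
    (hEv : E ⊆ {q | v q = ⊥}) {q : Fin n → ℍ} (hq : q ∈ Ω) (hvq : v q ≠ ⊥) :
    relExtremal E Ω q = 0 := by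
  have hw := hv.isQuatPlurisuperharmonicOn hv0
  have hwq : (-v q).toENNReal ≠ ⊤ := by simpa using hvq
  have hk : ∀ k : ℕ, (-relExtremal E Ω q).toENNReal ≤ (k + 1 : ℝ≥0∞)⁻¹ * (-v q).toENNReal := by
    intro k
    have hc : (k + 1 : ℝ≥0∞)⁻¹ ≠ ⊤ := by simp
    have hc0 : (k + 1 : ℝ≥0∞)⁻¹ ≠ 0 := by simp
    have hle : -(((k + 1 : ℝ≥0∞)⁻¹ * (-v q).toENNReal : ℝ≥0∞) : EReal) ≤ relExtremal E Ω q := by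
      refine le_sSup ⟨_, (hw.const_mul hc).isQuatPSH hΩ ⟨q, hq, ENNReal.mul_ne_top hc hwq⟩,
        fun p _ => EReal.neg_coe_ennreal_nonpos _, fun p hp => ?_, rfl⟩
      rw [show v p = ⊥ from hEv hp]
      simp [ENNReal.mul_top hc0]
    simpa only [neg_neg, EReal.toENNReal_coe] using EReal.antitone_neg_toENNReal hle
  have hlim : Tendsto (fun k : ℕ => (k + 1 : ℝ≥0∞)⁻¹ * (-v q).toENNReal) atTop (𝓝 0) := by
    have h := ENNReal.Tendsto.mul_const (b := (-v q).toENNReal)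
      ((tendsto_add_atTop_iff_nat 1).2 ENNReal.tendsto_inv_nat_nhds_zero) (Or.inr hwq)
    simpa using h
  have h0 : (-relExtremal E Ω q).toENNReal = 0 :=
    le_antisymm (ge_of_tendsto' hlim hk) zero_le
  rw [← EReal.neg_toENNReal_neg (relExtremal_nonpos hq), h0]
  simp

/-- If the regularized relative extremal function vanishes at one point, then a sum of competitors
which are nearly zero close to that point is a plurisubharmonic function equal to `-∞` on `E`. -/
theorem exists_isQuatPSH_of_uscReg_eq_zero (hΩo : IsOpen Ω) (hΩ : IsPreconnected Ω)
    {q₀ : Fin n → ℍ} (hq₀ : q₀ ∈ Ω) (h : uscReg Ω (relExtremal E Ω) q₀ = 0) :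
    ∃ v : (Fin n → ℍ) → EReal, IsQuatPSH Ω v ∧ (∀ q ∈ Ω, v q ≤ 0) ∧ E ⊆ {q | v q = ⊥} := by
  obtain ⟨r, hr, hrΩ⟩ := Metric.isOpen_iff.1 hΩo q₀ hq₀
  obtain ⟨ε, hε, hεsum⟩ := ENNReal.exists_pos_sum_of_countable' one_ne_zero ℕ
  have hex : ∀ j, ∃ (w : (Fin n → ℍ) → ℝ≥0∞) (q : Fin n → ℍ), IsQuatPlurisuperharmonicOn Ω w ∧
      (∀ p ∈ E, 1 ≤ w p) ∧ q ∈ Metric.ball q₀ (r / 3) ∧ w q ≤ ε j := by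
    intro j
    have hlt : -(ε j : EReal) < uscReg Ω (relExtremal E Ω) q₀ := by
      rw [h, EReal.neg_lt_comm]
      simpa using hε j
    have hfreq := (frequently_lt_of_lt_limsup (by isBoundedDefault) hlt).and_eventually
      (mem_nhdsWithin_of_mem_nhds (Metric.ball_mem_nhds q₀ (show 0 < r / 3 by positivity)))
    obtain ⟨q, hq, hqr⟩ := hfreq.exists
    obtain ⟨t, ⟨u, hu, hu0, huE, rfl⟩, hut⟩ := lt_sSup_iff.1 hq
    refine ⟨_, q, hu.isQuatPlurisuperharmonicOn hu0, fun p hp => ?_, hqr, ?_⟩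
    · have h1 : (-(-1 : EReal)).toENNReal = 1 := by
        rw [neg_neg, ← EReal.coe_ennreal_one, EReal.toENNReal_coe]
      exact h1.ge.trans (EReal.antitone_neg_toENNReal (huE p hp))
    · simpa using EReal.antitone_neg_toENNReal hut.le
  choose w q hw hwE hqr hwq using hex
  -- The ball of radius `r / 3` around `q₀` lies in the ball of radius `2 r / 3` around `q j`, which
  -- lies in `Ω`.
  have hint : ∀ j, ∫⁻ x in Metric.ball q₀ (r / 3), w j x ≤
      ε j * volume (Metric.ball (0 : Fin n → ℍ) (2 * r / 3)) := by
    intro j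
    have hd : dist (q j) q₀ < r / 3 := hqr j
    have hsub : Metric.ball (q j) (2 * r / 3) ⊆ Ω :=
      (Metric.ball_subset_ball' (by linarith)).trans hrΩ
    have hsub' : Metric.ball q₀ (r / 3) ⊆ Metric.ball (q j) (2 * r / 3) :=
      Metric.ball_subset_ball' (by rw [dist_comm]; linarith)
    calc ∫⁻ x in Metric.ball q₀ (r / 3), w j x
        ≤ ∫⁻ x in Metric.ball (q j) (2 * r / 3), w j x := lintegral_mono_set hsub'
      _ ≤ w j (q j) * volume (Metric.ball (q j) (2 * r / 3)) :=
        (hw j).lintegral_ball_le hΩo hsub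
      _ ≤ ε j * volume (Metric.ball (0 : Fin n → ℍ) (2 * r / 3)) := by
        rw [Measure.addHaar_ball_center]
        gcongr
        exact hwq j
  have hball : Metric.ball q₀ (r / 3) ⊆ Ω := (Metric.ball_subset_ball (by linarith)).trans hrΩ
  have hfin : ∃ x ∈ Ω, ∑' j, w j x ≠ ⊤ := by
    by_contra! htop
    have hmeas : ∀ j, AEMeasurable (w j) (volume.restrict (Metric.ball q₀ (r / 3))) := fun j =>
      ((hw j).lowerSemicontinuousOn.measurable_indicator hΩo).aemeasurable.congr
        ((ae_restrict_mem Metric.isOpen_ball.measurableSet).mono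
          fun x hx => indicator_of_mem (hball hx) _)
    have hlt : ∫⁻ x in Metric.ball q₀ (r / 3), ∑' j, w j x < ⊤ := by
      rw [lintegral_tsum hmeas]
      refine (ENNReal.tsum_le_tsum hint).trans_lt ?_
      rw [ENNReal.tsum_mul_right]
      exact ENNReal.mul_lt_top (hεsum.trans ENNReal.one_lt_top) measure_ball_lt_top
    rw [setLIntegral_congr_fun Metric.isOpen_ball.measurableSet fun x hx => htop x (hball hx),
      setLIntegral_const,
      ENNReal.top_mul (Metric.measure_ball_pos volume q₀ (by positivity)).ne'] at hlt
    exact hlt.ne rfl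
  refine ⟨_, (IsQuatPlurisuperharmonicOn.tsum hw).isQuatPSH hΩ hfin, fun q _ =>
    EReal.neg_coe_ennreal_nonpos _,
    fun p hp => ?_⟩
  have hsum : ∑' j, w j p = ⊤ := top_le_iff.1 <| calc
    (⊤ : ℝ≥0∞) = ∑' _ : ℕ, 1 := (ENNReal.tsum_const_eq_top_of_ne_zero one_ne_zero).symm
    _ ≤ ∑' j, w j p := ENNReal.tsum_le_tsum fun j => hwE j p hp
  simp [hsum]

end RelExtremal

theorem mainTheorem8 (n : ℕ) (Ω E : Set (Fin n → Quaternion ℝ)) (hΩo : IsOpen Ω)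
    (hΩc : IsConnected Ω) (hE : E ⊆ Ω) :
    (∀ q ∈ Ω, uscReg Ω (relExtremal E Ω) q = 0) ↔
      ∃ v : (Fin n → Quaternion ℝ) → EReal,
        IsQuatPSH Ω v ∧ (∀ q ∈ Ω, v q ≤ 0) ∧ E ⊆ {q | v q = ⊥} := by
  constructor
  · intro h
    obtain ⟨q₀, hq₀⟩ := hΩc.nonempty
    exact exists_isQuatPSH_of_uscReg_eq_zero hΩo hΩc.isPreconnected hq₀ (h q₀ hq₀)
  · rintro ⟨v, hv, hv0, hEv⟩ q hq
    have hne : ∃ p ∈ Ω, (-v p).toENNReal ≠ ⊤ := by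
      obtain ⟨p, hp, hvp⟩ := hv.exists_ne_bot q hq
      exact ⟨p, connectedComponentIn_subset _ _ hp, by simpa using hvp⟩
    have hfreq := (hv.isQuatPlurisuperharmonicOn hv0).frequently_ne_top hΩo hΩc.isPreconnected hne hq
    refine le_antisymm (limsup_le_of_le (by isBoundedDefault) ?_)
      (le_limsup_of_frequently_le ?_ (by isBoundedDefault))
    · filter_upwards [self_mem_nhdsWithin] with p hp using relExtremal_nonpos hp
    · rw [hΩo.nhdsWithin_eq hq]
      refine (hfreq.and_eventually (hΩo.mem_nhds hq)).mono fun p hp => ?_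
      exact (relExtremal_eq_zero_of_ne_bot hΩc.isPreconnected hv hv0 hEv hp.2
        (by simpa using hp.1)).ge
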